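/- Flat conditional expressions are built from simple conditionals $(a|b)$, where $a,b$ are events of a probability space $(\Omega,\mathfrak M,\Pr)$, by the operations $\land$, $\lor$ and $\sim$. In the product space (PS) semantics an expression denotes a subset of $\Omega^{\infty}$: \[ [\![(a|b)]\!]=\bigcup_{j\ge 0}(\Omega\setminus b)^{j}\times(a\cap b)\times\Omega\times\Omega\times\cdots, \] $[\![e\land e']\!]=[\![e]\!]\cap[\![e']\!]$, $[\![e\lor e']\!]=[\![e]\!]\cup[\![e']\!]$, $[\![\sim e]\!]=\Omega^\infty\setminus[\![e]\!]$, and the PS probability of $e$ is the measure of $[\![e]\!]$ under the product measure $\Pr^{\infty}$. An $n$-ary conditional expression $e$ is an expression in $n$ simple conditionals $(a_1|b_1),\dots,(a_n|b_n)$; its length $m$ is the number of occurrences of simple conditionals and connectives in it. Theorem. There are a single algorithm and a polynomial $q$ such that for all $n$ and $m$, for every $n$-ary conditional expression $e$ of length $m$, every probability space $(\Omega,\mathfrak M,\Pr)$ and all events $a_1,b_1,\dots,a_n,b_n\in\mathfrak M$, the following holds. On input consisting of $n$, the expression $e$ (as a word over its $n$ arguments and the connectives) and the probabilities of the $4^n$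 atomic Boolean combinations of $a_1,b_1,\dots,a_n,b_n$, the algorithm halts after at most $q(\max(m,2^n))$ steps and outputs the PS probability of $e$. Here algorithms are programs for a random access machine which stores natural and real numbers in arrays with indirect addressing and performs, at unit cost each, addition and truncated subtraction of natural numbers, addition, subtraction, multiplication and division of real numbers, comparisons, and reading or writing of a memory cell; the only real constants in a program are $0$ and $1$. -/

import Mathlib

open MeasureTheory

namespace PSCond

/-! ### Flat conditional expressions and the product space semantics -/

/-- Flat conditional expressions whose simple conditionals are taken from `α`.
`FlatExpr (Set Ω × Set Ω)` are the expressions over events of `Ω`, the pair `(a, b)` being the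
simple conditional `(a | b)`; `FlatExpr (Fin n)` are the `n`-ary expressions, with the letter `i`
standing for the `i`-th of the `n` arguments `(a_i | b_i)`. -/
inductive FlatExpr (α : Type*) where
  | simple (x : α) : FlatExpr α
  | neg (e : FlatExpr α) : FlatExpr α
  | and (e f : FlatExpr α) : FlatExpr α
  | or (e f : FlatExpr α) : FlatExpr α

/-- Substitution of simple conditionals for the arguments of an expression. -/
def FlatExpr.map {α β : Type*} (g : α → β) : FlatExpr α → FlatExpr β
  | .simple x => .simple (g x)
  | .neg e => .neg (e.map g)
  | .and e f => .and (e.map g) (f.map g)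
  | .or e f => .or (e.map g) (f.map g)

/-- The length of an expression: the number of occurrences of simple conditionals and
connectives. -/
def FlatExpr.length {α : Type*} : FlatExpr α → ℕ
  | .simple _ => 1
  | .neg e => e.length + 1
  | .and e f => e.length + f.length + 1
  | .or e f => e.length + f.length + 1

/-- The product space semantics: an expression over events of `Ω` denotes a set of infinite
sequences of elements of `Ω`. The simple conditional `(a | b)` denotes the union over `j` of the
cylinders `(Ω \ b)^j × (b ∩ a) × Ω × Ω × ⋯`. -/
def FlatExpr.ps {Ω : Type*} : FlatExpr (Set Ω × Set Ω) → Set (ℕ → Ω)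
  | .simple x => ⋃ j : ℕ, {w | (∀ k < j, w k ∈ x.2ᶜ) ∧ w j ∈ x.2 ∩ x.1}
  | .neg e => e.psᶜ
  | .and e f => e.ps ∩ f.ps
  | .or e f => e.ps ∪ f.ps

/-- The PS probability of an expression: the measure of its denotation under the countable
power of the probability measure `μ`. -/
noncomputable def FlatExpr.psProb {Ω : Type*} [MeasurableSpace Ω] (μ : Measure Ω)
    [IsProbabilityMeasure μ] (e : FlatExpr (Set Ω × Set Ω)) : ℝ :=
  (Measure.infinitePi (fun _ : ℕ => μ)).real e.ps

/-! ### A random access machine with real arithmetic at unit cost -/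

/-- The memory: countably many named arrays of natural numbers and countably many named arrays
of real numbers (a program mentions only finitely many names). -/
structure State where
  nat : ℕ → ℕ → ℕ
  real : ℕ → ℕ → ℝ

/-- Integer expressions (counters, addresses): literals, the entry of the array `k` at a computed
index, addition and truncated subtraction. -/
inductive NatExp where
  | lit (c : ℕ) : NatExp
  | get (k : ℕ) (i : NatExp) : NatExp
  | add (e f : NatExp) : NatExp
  | sub (e f : NatExp) : NatExp

def NatExp.eval (s : State) : NatExp → ℕ
  | .lit c => c
  | .get k i => s.nat k (i.eval s)
  | .add e f => e.eval s + f.eval s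
  | .sub e f => e.eval s - f.eval s

/-- Every operation has unit cost. -/
def NatExp.cost : NatExp → ℕ
  | .lit _ => 1
  | .get _ i => i.cost + 1
  | .add e f => e.cost + f.cost + 1
  | .sub e f => e.cost + f.cost + 1

/-- Real expressions: the constants 0 and 1, the entry of the array `k` at a computed index, and
the four arithmetical operations. -/
inductive RealExp where
  | zero : RealExp
  | one : RealExp
  | get (k : ℕ) (i : NatExp) : RealExp
  | add (e f : RealExp) : RealExp
  | sub (e f : RealExp) : RealExp
  | mul (e f : RealExp) : RealExp
  | div (e f : RealExp) : RealExp

/-- Division by zero returns zero; as a program can test whether a number is zero, this adds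
nothing to the power of the machine. -/
noncomputable def RealExp.eval (s : State) : RealExp → ℝ
  | .zero => 0
  | .one => 1
  | .get k i => s.real k (i.eval s)
  | .add e f => e.eval s + f.eval s
  | .sub e f => e.eval s - f.eval s
  | .mul e f => e.eval s * f.eval s
  | .div e f => e.eval s / f.eval s

/-- Every operation has unit cost. -/
def RealExp.cost : RealExp → ℕ
  | .zero => 1
  | .one => 1
  | .get _ i => i.cost + 1
  | .add e f => e.cost + f.cost + 1
  | .sub e f => e.cost + f.cost + 1
  | .mul e f => e.cost + f.cost + 1
  | .div e f => e.cost + f.cost + 1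

/-- Comparisons of two natural numbers or of two real numbers. -/
inductive Test where
  | natLt (e f : NatExp) : Test
  | natEq (e f : NatExp) : Test
  | realLt (e f : RealExp) : Test
  | realEq (e f : RealExp) : Test

def Test.holds (s : State) : Test → Prop
  | .natLt e f => e.eval s < f.eval s
  | .natEq e f => e.eval s = f.eval s
  | .realLt e f => e.eval s < f.eval s
  | .realEq e f => e.eval s = f.eval s

def Test.cost : Test → ℕ
  | .natLt e f => e.cost + f.cost + 1
  | .natEq e f => e.cost + f.cost + 1
  | .realLt e f => e.cost + f.cost + 1
  | .realEq e f => e.cost + f.cost + 1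

/-- Programs. `setNat k i e` stores the value of `e` in the array `k` at the index `i`, and
similarly for `setReal`. -/
inductive Program where
  | skip : Program
  | setNat (k : ℕ) (i e : NatExp) : Program
  | setReal (k : ℕ) (i : NatExp) (e : RealExp) : Program
  | seq (P Q : Program) : Program
  | cond (b : Test) (P Q : Program) : Program
  | loop (b : Test) (P : Program) : Program

def State.setNat (s : State) (k i v : ℕ) : State :=
  { s with nat := fun k' i' => if k' = k ∧ i' = i then v else s.nat k' i' }

noncomputable def State.setReal (s : State) (k i : ℕ) (v : ℝ) : State :=
  { s with real := fun k' i' => if k' = k ∧ i' = i then v else s.real k' i' }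

/-- `Exec P s s' t`: started in the state `s`, the program `P` halts after exactly `t` elementary
operations, in the state `s'`. The program `loop b P` repeats `P` as long as `b` holds. -/
inductive Exec : Program → State → State → ℕ → Prop
  | skip (s : State) : Exec .skip s s 1
  | setNat (k : ℕ) (i e : NatExp) (s : State) :
      Exec (.setNat k i e) s (s.setNat k (i.eval s) (e.eval s)) (i.cost + e.cost + 1)
  | setReal (k : ℕ) (i : NatExp) (e : RealExp) (s : State) :
      Exec (.setReal k i e) s (s.setReal k (i.eval s) (e.eval s)) (i.cost + e.cost + 1)
  | seq {P Q : Program} {s s' s'' : State} {t t' : ℕ} :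
      Exec P s s' t → Exec Q s' s'' t' → Exec (.seq P Q) s s'' (t + t')
  | condTrue {b : Test} {P Q : Program} {s s' : State} {t : ℕ} :
      b.holds s → Exec P s s' t → Exec (.cond b P Q) s s' (b.cost + t)
  | condFalse {b : Test} {P Q : Program} {s s' : State} {t : ℕ} :
      ¬ b.holds s → Exec Q s s' t → Exec (.cond b P Q) s s' (b.cost + t)
  | loopTrue {b : Test} {P : Program} {s s' s'' : State} {t t' : ℕ} :
      b.holds s → Exec P s s' t → Exec (.loop b P) s' s'' t' →
        Exec (.loop b P) s s'' (b.cost + t + t')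
  | loopFalse {b : Test} {P : Program} {s : State} :
      ¬ b.holds s → Exec (.loop b P) s s b.cost

/-- The machine is deterministic: the final state and the running time are functions of the
program and the initial state. -/
theorem Exec.deterministic {P : Program} {s s₁ s₂ : State} {t₁ t₂ : ℕ}
    (h₁ : Exec P s s₁ t₁) (h₂ : Exec P s s₂ t₂) : s₁ = s₂ ∧ t₁ = t₂ := by
  induction h₁ generalizing s₂ t₂ with
  | skip | setNat | setReal => cases h₂; exact ⟨rfl, rfl⟩
  | seq _ _ ih ih' =>
    cases h₂ with
    | seq k k' =>
      obtain ⟨rfl, rfl⟩ := ih k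
      obtain ⟨rfl, rfl⟩ := ih' k'
      exact ⟨rfl, rfl⟩
  | condTrue hb _ ih =>
    cases h₂ with
    | condTrue _ k => obtain ⟨rfl, rfl⟩ := ih k; exact ⟨rfl, rfl⟩
    | condFalse hn _ => exact absurd hb hn
  | condFalse hb _ ih =>
    cases h₂ with
    | condTrue hn _ => exact absurd hn hb
    | condFalse _ k => obtain ⟨rfl, rfl⟩ := ih k; exact ⟨rfl, rfl⟩
  | loopTrue hb _ _ ih ih' =>
    cases h₂ with
    | loopTrue _ k k' =>
      obtain ⟨rfl, rfl⟩ := ih k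
      obtain ⟨rfl, rfl⟩ := ih' k'
      exact ⟨rfl, rfl⟩
    | loopFalse hn => exact absurd hb hn
  | loopFalse hb =>
    cases h₂ with
    | loopTrue hn _ _ => exact absurd hn hb
    | loopFalse _ => exact ⟨rfl, rfl⟩

/-! ### The input of the algorithm -/

/-- An `n`-ary expression as a word, in reverse Polish notation. The connectives are the letters
0, 1, 2, and the `i`-th argument is the letter `i + 3`. -/
def FlatExpr.word {n : ℕ} : FlatExpr (Fin n) → List ℕ
  | .simple i => [(i : ℕ) + 3]
  | .neg e => e.word ++ [0]
  | .and e f => e.word ++ f.word ++ [1]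
  | .or e f => e.word ++ f.word ++ [2]

/-- For `j < 4 ^ n`, the `j`-th atomic Boolean combination of the events
`a_0, b_0, …, a_(n-1), b_(n-1)`: the binary digits of `j` in the places `2 i` and `2 i + 1` tell
whether `a_i` and `b_i` happen. -/
def atom {Ω : Type*} {n : ℕ} (a b : Fin n → Set Ω) (j : ℕ) : Set Ω :=
  {ω | ∀ i : Fin n, (ω ∈ a i ↔ j.testBit (2 * (i : ℕ)) = true) ∧
    (ω ∈ b i ↔ j.testBit (2 * (i : ℕ) + 1) = true)}

/-- The initial state of the machine on the `n`-ary expression `e` and the table `p` of the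
probabilities of the `4 ^ n` atomic Boolean combinations of its arguments. The integer array `0`
holds `n` and the length of the word of `e`, the integer array `1` holds this word, and the real
array `0` holds the table. All other entries are zero. -/
noncomputable def inputState {n : ℕ} (e : FlatExpr (Fin n)) (p : ℕ → ℝ) : State where
  nat k i :=
    if k = 0 then (if i = 0 then n else if i = 1 then e.word.length else 0)
    else if k = 1 then e.word.getD i 0
    else 0
  real k i := if k = 0 ∧ i < 4 ^ n then p i else 0

end PSCond

open PSCond

open PSCond

namespace PSCond

/-! Read the sequence in `Ω^∞` entry by entry. Each conditional `(a_i | b_i)` stays undecided until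
`b_i` first occurs, and then `a_i` decides it for good. The status of all `n` conditionals is a
record `x < 4 ^ n`, and an entry in the `j`-th atom moves `x` to `step n x j`. Splitting off the
first entry preserves the product measure (`map_consSeq`), so the probabilities `F x` of the
expression after the records satisfy `F x = ∑ j, p j * F (step n x j)` (`recordProb_eq_sum`), and `F
0` is the PS probability.

Steps never decrease a record (`le_step`), so this linear system is triangular and its only cycles
are self-loops. Since the `p j` sum to one, the self-loops move to the left-hand side, giving `F x`
as a quotient by the probability of leaving `x` (`leaveProb_mul_recordProb`). If that probability is
zero, almost surely nothing undecided is ever decided, and `F x` is the truth value of the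
expression with the undecided conditionals false (`recordProb_of_leaveProb_eq_zero`).

The program fills the table of `F` from the largest record down to `0`. Each of the `4 ^ n` records
costs one evaluation of the word and `4 ^ n` transitions of `O(n)` steps; as `4 ^ n = (2 ^ n) ^ 2`,
this is polynomial in `max m (2 ^ n)`. Correctness is proved with loop invariants (`Runs.loop`) and
a syntactic frame rule (`Exec.frame`). -/

/-! ### Base four digits -/

/-- The `i`-th base four digit of `x`. -/
def digit (x i : ℕ) : ℕ := x / 4 ^ i % 4

theorem digit_lt (x i : ℕ) : digit x i < 4 := Nat.mod_lt _ (by norm_num)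

theorem digit_zero_left (i : ℕ) : digit 0 i = 0 := by simp [digit]

theorem digit_succ (x i : ℕ) : digit x (i + 1) = digit (x / 4) i := by
  simp [digit, pow_succ', Nat.div_div_eq_div_mul]

/-- The number with the base four digits `c 0, …, c (n - 1)`. -/
def ofBaseFour (n : ℕ) (c : ℕ → ℕ) : ℕ := ∑ i ∈ Finset.range n, c i * 4 ^ i

/-- Horner form: it drives the inductions on the number of digits and is the update made in each
round of `stepProg`. -/
theorem ofBaseFour_succ (n : ℕ) (c : ℕ → ℕ) :
    ofBaseFour (n + 1) c = 4 * ofBaseFour n (fun i => c (i + 1)) + c 0 := by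
  simp only [ofBaseFour, Finset.sum_range_succ', pow_zero, mul_one, Finset.mul_sum]
  congr 1
  exact Finset.sum_congr rfl fun i _ => by ring

theorem ofBaseFour_lt {n : ℕ} {c : ℕ → ℕ} (hc : ∀ i, c i < 4) : ofBaseFour n c < 4 ^ n := by
  induction n generalizing c with
  | zero => simp [ofBaseFour]
  | succ n ih =>
    have h := ih (c := fun i => c (i + 1)) fun i => hc _
    have h0 := hc 0
    rw [ofBaseFour_succ, pow_succ]
    omega

theorem digit_ofBaseFour {n : ℕ} {c : ℕ → ℕ} (hc : ∀ i, c i < 4) {i : ℕ} (hi : i < n) :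
    digit (ofBaseFour n c) i = c i := by
  induction n generalizing c i with
  | zero => omega
  | succ n ih =>
    have h0 := hc 0
    rw [ofBaseFour_succ]
    cases i with
    | zero => simp only [digit, pow_zero, Nat.div_one]; omega
    | succ i =>
      rw [digit_succ, ← ih (c := fun i => c (i + 1)) (fun i => hc _) (Nat.lt_of_succ_lt_succ hi)]
      congr 1
      omega

theorem ofBaseFour_digit {n x : ℕ} (hx : x < 4 ^ n) : ofBaseFour n (digit x) = x := by
  induction n generalizing x with
  | zero => simp_all [ofBaseFour]
  | succ n ih =>
    rw [ofBaseFour_succ]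
    simp only [digit_succ]
    rw [ih (by rw [pow_succ] at hx; omega)]
    simp only [digit, pow_zero, Nat.div_one]
    omega

theorem ofBaseFour_congr {n : ℕ} {c d : ℕ → ℕ} (h : ∀ i < n, c i = d i) :
    ofBaseFour n c = ofBaseFour n d :=
  Finset.sum_congr rfl fun i hi => by rw [h i (Finset.mem_range.1 hi)]

/-! ### The transitions between partial evaluations -/

/-- A digit `3` or `2` records that a conditional has been decided, and is true or false; the
digits `0` and `1` that it is undecided. The digit `d'` of an atom decides an undecided
conditional if it is at least `2`. -/
def stepDigit (d d' : ℕ) : ℕ := if d < 2 ∧ 2 ≤ d' then d' else d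

/-- The record after a point of the `j`-th atom has been observed in the record `x`. -/
def step (n x j : ℕ) : ℕ := ofBaseFour n fun i => stepDigit (digit x i) (digit j i)

theorem stepDigit_lt {d d' : ℕ} (h : d < 4) (h' : d' < 4) : stepDigit d d' < 4 := by
  unfold stepDigit; split_ifs <;> assumption

theorem step_lt (n x j : ℕ) : step n x j < 4 ^ n :=
  ofBaseFour_lt fun i => stepDigit_lt (digit_lt x i) (digit_lt j i)

theorem digit_step {n i : ℕ} (x j : ℕ) (hi : i < n) :
    digit (step n x j) i = stepDigit (digit x i) (digit j i) :=
  digit_ofBaseFour (fun i => stepDigit_lt (digit_lt x i) (digit_lt j i)) hi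

/-- A digit changes only from below `2` to at least `2`, so no digit decreases. This makes the
system of equations triangular. -/
theorem le_step {n x : ℕ} (j : ℕ) (hx : x < 4 ^ n) : x ≤ step n x j := by
  conv_lhs => rw [← ofBaseFour_digit hx]
  refine Finset.sum_le_sum fun i _ => Nat.mul_le_mul_right _ ?_
  simp only [stepDigit]
  split_ifs <;> omega

/-! ### Truth values of expressions -/

/-- The truth value of an expression under an assignment of truth values to its letters. -/
def FlatExpr.Holds {α : Type*} (v : α → Prop) : FlatExpr α → Prop
  | .simple x => v x
  | .neg e => ¬ e.Holds v
  | .and e f => e.Holds v ∧ f.Holds v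
  | .or e f => e.Holds v ∨ f.Holds v

theorem FlatExpr.holds_congr {α : Type*} {v v' : α → Prop} (h : ∀ i, v i ↔ v' i)
    (e : FlatExpr α) : e.Holds v ↔ e.Holds v' := by
  rw [show v = v' from funext fun i => propext (h i)]

theorem FlatExpr.mem_ps_map {α Ω : Type*} (g : α → Set Ω × Set Ω) (e : FlatExpr α) (w : ℕ → Ω) :
    w ∈ (e.map g).ps ↔ e.Holds fun i => w ∈ (FlatExpr.simple (g i)).ps := by
  induction e with
  | simple x => rfl
  | neg e ih => simp only [FlatExpr.map, FlatExpr.ps, Set.mem_compl_iff, ih, FlatExpr.Holds]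
  | and e f ih ih' => simp only [FlatExpr.map, FlatExpr.ps, Set.mem_inter_iff, ih, ih', FlatExpr.Holds]
  | or e f ih ih' => simp only [FlatExpr.map, FlatExpr.ps, Set.mem_union, ih, ih', FlatExpr.Holds]

theorem FlatExpr.measurableSet_setOf_holds {α β : Type*} [MeasurableSpace β] {v : β → α → Prop}
    (h : ∀ i, MeasurableSet {w | v w i}) (e : FlatExpr α) : MeasurableSet {w | e.Holds (v w)} := by
  induction e with
  | simple x => exact h x
  | neg e ih => exact ih.compl
  | and e f ih ih' => exact ih.inter ih'
  | or e f ih ih' => exact ih.union ih'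

theorem FlatExpr.length_word {n : ℕ} (e : FlatExpr (Fin n)) : e.word.length = e.length := by
  induction e <;> simp_all [FlatExpr.word, FlatExpr.length, add_assoc]

/-! ### Sequences with a new first entry -/

/-- The sequence `ω, w 0, w 1, …`. -/
def consSeq {Ω : Type*} (p : Ω × (ℕ → Ω)) : ℕ → Ω
  | 0 => p.1
  | k + 1 => p.2 k

section

variable {Ω : Type*}

/-- Either the first entry decides the conditional, or the same question is asked again of the tail.
-/
theorem consSeq_mem_ps_simple (a b : Set Ω) (ω : Ω) (w : ℕ → Ω) :
    consSeq (ω, w) ∈ (FlatExpr.simple (a, b)).ps ↔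
      ω ∈ b ∧ ω ∈ a ∨ ω ∉ b ∧ w ∈ (FlatExpr.simple (a, b)).ps := by
  simp only [FlatExpr.ps, Set.mem_iUnion, Set.mem_ofPred_eq]
  constructor
  · rintro ⟨j, hj, hj'⟩
    cases j with
    | zero => exact Or.inl hj'
    | succ j => exact Or.inr ⟨hj 0 j.succ_pos, j, fun k hk => hj (k + 1) (by omega), hj'⟩
  · rintro (h | ⟨h, j, hj, hj'⟩)
    · exact ⟨0, by simp, h⟩
    · refine ⟨j + 1, fun k hk => ?_, hj'⟩
      cases k with
      | zero => exact h
      | succ k => exact hj k (by omega)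

theorem measurable_consSeq [MeasurableSpace Ω] : Measurable (consSeq : Ω × (ℕ → Ω) → ℕ → Ω) := by
  refine measurable_pi_lambda _ fun k => ?_
  cases k with
  | zero => exact measurable_fst
  | succ k => exact (measurable_pi_apply k).comp measurable_snd

/-- The product measure is determined by its values on finite-dimensional boxes, and such a box
pulls back to the product of its first side with a box in the remaining coordinates. -/
theorem map_consSeq [MeasurableSpace Ω] (μ : Measure Ω) [IsProbabilityMeasure μ] :
    (μ.prod (Measure.infinitePi fun _ : ℕ => μ)).map consSeq =
      Measure.infinitePi fun _ : ℕ => μ := by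
  classical
  refine Measure.eq_infinitePi _ fun s t ht => ?_
  obtain ⟨N, hN⟩ := s.exists_nat_subset_range
  -- Padding with the whole space replaces `s` by an initial segment, which behaves well under the
  -- shift of indices.
  let t' : ℕ → Set Ω := fun i => if i ∈ s then t i else Set.univ
  have ht' : ∀ i, MeasurableSet (t' i) := fun i => by
    by_cases hi : i ∈ s <;> simp [t', hi, ht]
  have hpre : consSeq ⁻¹' (Set.pi (s : Set ℕ) t) =
      t' 0 ×ˢ Set.pi (Finset.range N : Set ℕ) (fun i => t' (i + 1)) := by
    ext ⟨ω, w⟩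
    simp only [Set.mem_preimage, Set.mem_pi, Set.mem_prod, Finset.mem_coe, Finset.mem_range, t']
    constructor
    · intro h
      refine ⟨?_, fun i _ => ?_⟩
      · split_ifs with h0
        · exact h 0 h0
        · trivial
      · split_ifs with h0
        · exact h (i + 1) h0
        · trivial
    · rintro ⟨h0, h1⟩ i hi
      cases i with
      | zero => rwa [if_pos hi] at h0
      | succ i =>
        have := h1 i (by have := Finset.mem_range.1 (hN hi); omega)
        rwa [if_pos hi] at this
  rw [Measure.map_apply measurable_consSeq (.pi s.countable_toSet fun i _ => ht i), hpre,
    Measure.prod_prod, Measure.infinitePi_pi _ fun i _ => ht' _]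
  have hsub : s ⊆ Finset.range (N + 1) := fun i hi =>
    Finset.mem_range.2 ((Finset.mem_range.1 (hN hi)).trans N.lt_succ_self)
  calc μ (t' 0) * ∏ i ∈ Finset.range N, μ (t' (i + 1))
      = ∏ i ∈ Finset.range (N + 1), μ (t' i) := by rw [Finset.prod_range_succ', mul_comm]
    _ = ∏ i ∈ s, μ (t' i) :=
        (Finset.prod_subset hsub fun i _ hi => by simp [t', hi]).symm
    _ = ∏ i ∈ s, μ (t i) := Finset.prod_congr rfl fun i hi => by simp [t', hi]

/-! ### The atoms -/

/-- The two bits for `a i` and `b i` form one base four digit. Digits `2` and `3` thus mean that `b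
i` happens without and with `a i`, so deciding a conditional amounts to copying the atom's digit
into the record. -/
theorem mem_atom_iff {n : ℕ} (a b : Fin n → Set Ω) (j : ℕ) (ω : Ω) :
    ω ∈ atom a b j ↔ ∀ i : Fin n, (ω ∈ a i ↔ digit j i % 2 = 1) ∧ (ω ∈ b i ↔ 2 ≤ digit j i) := by
  refine forall_congr' fun i => ?_
  have h : (2 : ℕ) ^ (2 * (i : ℕ)) = 4 ^ (i : ℕ) := by rw [pow_mul]; norm_num
  rw [Nat.testBit_eq_decide_div_mod_eq, Nat.testBit_eq_decide_div_mod_eq, pow_succ,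
    ← Nat.div_div_eq_div_mul, h, digit]
  generalize j / 4 ^ (i : ℕ) = y
  simp only [decide_eq_true_eq]
  rw [show y / 2 % 2 = 1 ↔ 2 ≤ y % 4 by omega, show y % 2 = 1 ↔ y % 4 % 2 = 1 by omega]

theorem exists_mem_atom {n : ℕ} (a b : Fin n → Set Ω) (ω : Ω) : ∃ j < 4 ^ n, ω ∈ atom a b j := by
  classical
  let c : ℕ → ℕ := fun i => if h : i < n then
    (if ω ∈ a ⟨i, h⟩ then 1 else 0) + (if ω ∈ b ⟨i, h⟩ then 2 else 0) else 0
  have hc : ∀ i, c i < 4 := fun i => by simp only [c]; split_ifs <;> norm_num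
  refine ⟨ofBaseFour n c, ofBaseFour_lt hc, (mem_atom_iff a b _ ω).2 fun i => ?_⟩
  rw [digit_ofBaseFour hc i.2]
  simp only [c, i.2, dif_pos, Fin.eta]
  split_ifs <;> simp_all

theorem eq_of_mem_atom {n : ℕ} {a b : Fin n → Set Ω} {ω : Ω} {j j' : ℕ} (hj : j < 4 ^ n)
    (hj' : j' < 4 ^ n) (h : ω ∈ atom a b j) (h' : ω ∈ atom a b j') : j = j' := by
  rw [mem_atom_iff] at h h'
  rw [← ofBaseFour_digit hj, ← ofBaseFour_digit hj']
  refine ofBaseFour_congr fun i hi => ?_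
  have h1 := h ⟨i, hi⟩
  have h2 := h' ⟨i, hi⟩
  have e1 := h1.1.symm.trans h2.1
  have e2 := h1.2.symm.trans h2.2
  have d1 := digit_lt j i
  have d2 := digit_lt j' i
  simp only at e1 e2
  omega

theorem measurableSet_atom [MeasurableSpace Ω] {n : ℕ} {a b : Fin n → Set Ω}
    (ha : ∀ i, MeasurableSet (a i))
    (hb : ∀ i, MeasurableSet (b i)) (j : ℕ) : MeasurableSet (atom a b j) := by
  have : atom a b j = ⋂ i, {ω | (ω ∈ a i ↔ j.testBit (2 * (i : ℕ)) = true) ∧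
      (ω ∈ b i ↔ j.testBit (2 * (i : ℕ) + 1) = true)} := by
    ext; simp [atom]
  rw [this]
  refine .iInter fun i => .inter ?_ ?_
  · exact (ha i).iff (.const _)
  · exact (hb i).iff (.const _)

/-! ### The recursion for the probabilities -/

/-- The truth of the `i`-th conditional when the record `x` precedes the sequence `w`. -/
def Decided {n : ℕ} (a b : Fin n → Set Ω) (x : ℕ) (w : ℕ → Ω) (i : Fin n) : Prop :=
  digit x i = 3 ∨ digit x i < 2 ∧ w ∈ (FlatExpr.simple (a i, b i)).ps

/-- The effect of the first entry is entirely absorbed into the record; this is the Markov property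
behind the recursion. -/
theorem decided_consSeq {n : ℕ} {a b : Fin n → Set Ω} {j : ℕ} {ω : Ω} (h : ω ∈ atom a b j)
    (x : ℕ) (w : ℕ → Ω) (i : Fin n) :
    Decided a b x (consSeq (ω, w)) i ↔ Decided a b (step n x j) w i := by
  obtain ⟨h1, h2⟩ := (mem_atom_iff a b j ω).1 h i
  rw [Decided, Decided, consSeq_mem_ps_simple, digit_step x j i.2, h1, h2, stepDigit]
  have := digit_lt j i
  have := digit_lt x i
  by_cases hd : digit x i < 2 <;> by_cases hd' : 2 ≤ digit j i <;> simp [hd, hd']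
  all_goals omega

variable [MeasurableSpace Ω]

/-- The probability of the expression `e` after the record `x`. -/
noncomputable def recordProb {n : ℕ} (μ : Measure Ω) [IsProbabilityMeasure μ] (a b : Fin n → Set Ω)
    (e : FlatExpr (Fin n)) (x : ℕ) : ℝ :=
  (Measure.infinitePi fun _ : ℕ => μ).real {w | e.Holds (Decided a b x w)}

variable {n : ℕ} {μ : Measure Ω} [IsProbabilityMeasure μ] {a b : Fin n → Set Ω}

theorem recordProb_zero (e : FlatExpr (Fin n)) :
    recordProb μ a b e 0 = (e.map fun i => (a i, b i)).psProb μ := by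
  unfold recordProb FlatExpr.psProb
  congr 1
  ext w
  rw [FlatExpr.mem_ps_map]
  exact FlatExpr.holds_congr (fun i => by simp [Decided, digit_zero_left]) e

theorem measurableSet_ps_simple {a b : Set Ω} (ha : MeasurableSet a) (hb : MeasurableSet b) :
    MeasurableSet (FlatExpr.simple (a, b)).ps := by
  refine .iUnion fun j => .inter ?_ ?_
  · have : {w : ℕ → Ω | ∀ k < j, w k ∈ bᶜ} = ⋂ k, ⋂ _ : k < j, (fun w => w k) ⁻¹' bᶜ := by
      ext; simp
    change MeasurableSet {w : ℕ → Ω | ∀ k < j, w k ∈ bᶜ}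
    rw [this]
    exact .iInter fun k => .iInter fun _ => measurable_pi_apply k hb.compl
  · exact measurable_pi_apply j (hb.inter ha)

theorem measurableSet_holds_decided (ha : ∀ i, MeasurableSet (a i)) (hb : ∀ i, MeasurableSet (b i))
    (e : FlatExpr (Fin n)) (x : ℕ) : MeasurableSet {w | e.Holds (Decided a b x w)} :=
  e.measurableSet_setOf_holds fun i =>
    .union (.const _) (.inter (.const _) (measurableSet_ps_simple (ha i) (hb i)))

theorem sum_measureReal_atom (ha : ∀ i, MeasurableSet (a i)) (hb : ∀ i, MeasurableSet (b i)) :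
    ∑ j ∈ Finset.range (4 ^ n), μ.real (atom a b j) = 1 := by
  rw [← measureReal_biUnion_finset _ fun j _ => measurableSet_atom ha hb j]
  · have : ⋃ j ∈ Finset.range (4 ^ n), atom a b j = Set.univ :=
      Set.eq_univ_of_forall fun ω => by simpa using exists_mem_atom a b ω
    rw [this, probReal_univ]
  · intro j hj j' hj' hne
    refine Set.disjoint_left.2 fun ω h h' => hne (eq_of_mem_atom ?_ ?_ h h')
    · simpa using hj
    · simpa using hj'

/-- Condition on the atom of the first entry: the atoms partition `Ω`, and the tail is independent
of the first entry with the same law as the whole sequence. -/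
theorem recordProb_eq_sum (ha : ∀ i, MeasurableSet (a i)) (hb : ∀ i, MeasurableSet (b i))
    (e : FlatExpr (Fin n)) (x : ℕ) :
    recordProb μ a b e x =
      ∑ j ∈ Finset.range (4 ^ n), μ.real (atom a b j) * recordProb μ a b e (step n x j) := by
  have hpre : consSeq ⁻¹' {w | e.Holds (Decided a b x w)} = ⋃ j ∈ Finset.range (4 ^ n),
      atom a b j ×ˢ {w | e.Holds (Decided a b (step n x j) w)} := by
    ext ⟨ω, w⟩
    simp only [Set.mem_preimage, Set.mem_ofPred_eq, Set.mem_iUnion, Set.mem_prod, Finset.mem_range,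
      exists_prop]
    constructor
    · intro h
      obtain ⟨j, hj, hω⟩ := exists_mem_atom a b ω
      exact ⟨j, hj, hω, (e.holds_congr fun i => decided_consSeq hω x w i).1 h⟩
    · rintro ⟨j, -, hω, h⟩
      exact (e.holds_congr fun i => decided_consSeq hω x w i).2 h
  have hm := measurableSet_holds_decided ha hb e
  unfold recordProb
  conv_lhs => rw [← map_consSeq μ]
  rw [map_measureReal_apply measurable_consSeq (hm x), hpre, measureReal_biUnion_finset]
  · exact Finset.sum_congr rfl fun j _ => measureReal_prod_prod _ _
  · intro j hj j' hj' hne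
    refine Set.disjoint_left.2 fun p h h' => hne (eq_of_mem_atom ?_ ?_ h.1 h'.1)
    · simpa using hj
    · simpa using hj'
  · exact fun j _ => (measurableSet_atom ha hb j).prod (hm _)

/-- The probability that the next observation changes the record `x`. -/
noncomputable def leaveProb (n : ℕ) (p : ℕ → ℝ) (x : ℕ) : ℝ :=
  ∑ j ∈ Finset.range (4 ^ n), if step n x j = x then 0 else p j

theorem leaveProb_mul_recordProb (ha : ∀ i, MeasurableSet (a i)) (hb : ∀ i, MeasurableSet (b i))
    (e : FlatExpr (Fin n)) (x : ℕ) :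
    leaveProb n (fun j => μ.real (atom a b j)) x * recordProb μ a b e x =
      ∑ j ∈ Finset.range (4 ^ n), if step n x j = x then 0 else
        μ.real (atom a b j) * recordProb μ a b e (step n x j) := by
  have h1 := recordProb_eq_sum (μ := μ) ha hb e x
  have h2 := sum_measureReal_atom (μ := μ) ha hb
  -- Because the weights sum to one, the recursion says that the mean increment is zero; self-loops
  -- contribute nothing to it, so no geometric series is needed.
  have h3 : ∑ j ∈ Finset.range (4 ^ n), μ.real (atom a b j) *
      (recordProb μ a b e (step n x j) - recordProb μ a b e x) = 0 := by
    simp only [mul_sub, Finset.sum_sub_distrib, ← Finset.sum_mul, h2, ← h1]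
    ring
  rw [leaveProb, Finset.sum_mul, ← sub_eq_zero, ← Finset.sum_sub_distrib, ← neg_eq_zero,
    ← Finset.sum_neg_distrib]
  refine Eq.trans ?_ h3
  refine Finset.sum_congr rfl fun j _ => ?_
  split_ifs with h
  · rw [h]; ring
  · ring

-- Every atom that would decide something is null, so almost surely no entry lies in `b i` for an
-- undecided `i`, and such a conditional is false.
open Classical in
theorem recordProb_of_leaveProb_eq_zero (e : FlatExpr (Fin n)) (x : ℕ)
    (h : leaveProb n (fun j => μ.real (atom a b j)) x = 0) :
    recordProb μ a b e x = if e.Holds (fun i : Fin n => digit x i = 3) then 1 else 0 := by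
  have hz : ∀ j < 4 ^ n, step n x j ≠ x → μ (atom a b j) = 0 := by
    intro j hj hne
    have := (Finset.sum_eq_zero_iff_of_nonneg fun j _ => by split_ifs <;> positivity).1 h j
      (Finset.mem_range.2 hj)
    rw [if_neg hne] at this
    exact (measureReal_eq_zero_iff).1 this
  have hae : ∀ᵐ ω ∂μ, ∀ i : Fin n, digit x i < 2 → ω ∉ b i := by
    have : ∀ᵐ ω ∂μ, ∀ j ∈ Finset.range (4 ^ n), step n x j ≠ x → ω ∉ atom a b j := by
      refine (Finset.eventually_all _).2 fun j hj => ?_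
      by_cases hne : step n x j = x
      · simp [hne]
      · filter_upwards [measure_eq_zero_iff_ae_notMem.1 (hz j (Finset.mem_range.1 hj) hne)]
          with ω hω _ using hω
    filter_upwards [this] with ω hω i hi hbi
    obtain ⟨j, hj, hmem⟩ := exists_mem_atom a b ω
    have hx : step n x j = x := by
      by_contra hne
      exact hω j (Finset.mem_range.2 hj) hne hmem
    have h2 := (((mem_atom_iff a b j ω).1 hmem i).2).1 hbi
    -- If `ω` were in `b i`, the step would write a digit at least `2` in place `i`, yet it leaves
    -- `x` fixed.
    have := digit_step x j i.2
    rw [hx, stepDigit, if_pos ⟨hi, h2⟩] at this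
    omega
  -- Each coordinate has law `μ`, and there are countably many of them.
  have hae' : ∀ᵐ w ∂(Measure.infinitePi fun _ : ℕ => μ), ∀ k, ∀ i : Fin n,
      digit x i < 2 → w k ∉ b i :=
    ae_all_iff.2 fun k =>
      (measurePreserving_eval_infinitePi (fun _ : ℕ => μ) k).quasiMeasurePreserving.ae hae
  have heq : {w | e.Holds (Decided a b x w)} =ᵐ[Measure.infinitePi fun _ : ℕ => μ]
      {_w | e.Holds (fun i : Fin n => digit x i = 3)} := by
    filter_upwards [hae'] with w hw
    refine propext (e.holds_congr fun i => ?_)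
    refine ⟨?_, Or.inl⟩
    rintro (h | ⟨h, hm⟩)
    · exact h
    · obtain ⟨j, -, hj⟩ := Set.mem_iUnion.1 hm
      exact absurd hj.1 (hw j i h)
  rw [recordProb, measureReal_congr heq]
  split_ifs with hc <;> simp [hc]

end

/-! ### Total correctness with running times -/

/-- Started in `s`, the program `P` halts in a state and after a time which satisfy `Q`. -/
def Runs (P : Program) (s : State) (Q : State → ℕ → Prop) : Prop :=
  ∃ s' t, Exec P s s' t ∧ Q s' t

theorem Runs.mono {P : Program} {s : State} {Q Q' : State → ℕ → Prop} (h : Runs P s Q)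
    (hQ : ∀ s' t, Q s' t → Q' s' t) : Runs P s Q' := by
  obtain ⟨s', t, h, hq⟩ := h
  exact ⟨s', t, h, hQ _ _ hq⟩

theorem runs_skip {s : State} {Q : State → ℕ → Prop} : Runs .skip s Q ↔ Q s 1 :=
  ⟨fun ⟨_, _, h, hq⟩ => by cases h; exact hq, fun h => ⟨_, _, .skip s, h⟩⟩

theorem runs_setNat {k : ℕ} {i e : NatExp} {s : State} {Q : State → ℕ → Prop} :
    Runs (.setNat k i e) s Q ↔ Q (s.setNat k (i.eval s) (e.eval s)) (i.cost + e.cost + 1) :=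
  ⟨fun ⟨_, _, h, hq⟩ => by cases h; exact hq, fun h => ⟨_, _, .setNat k i e s, h⟩⟩

theorem runs_setReal {k : ℕ} {i : NatExp} {e : RealExp} {s : State} {Q : State → ℕ → Prop} :
    Runs (.setReal k i e) s Q ↔ Q (s.setReal k (i.eval s) (e.eval s)) (i.cost + e.cost + 1) :=
  ⟨fun ⟨_, _, h, hq⟩ => by cases h; exact hq, fun h => ⟨_, _, .setReal k i e s, h⟩⟩

/-- Like the rules for assignments and conditionals, this is an equivalence, so that straight-line
code is executed by rewriting. -/
theorem runs_seq {P R : Program} {s : State} {Q : State → ℕ → Prop} :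
    Runs (.seq P R) s Q ↔ Runs P s fun s' t => Runs R s' fun s'' t' => Q s'' (t + t') := by
  constructor
  · rintro ⟨s', t, h, hq⟩
    cases h with
    | seq h h' => exact ⟨_, _, h, _, _, h', hq⟩
  · rintro ⟨s', t, h, s'', t', h', hq⟩
    exact ⟨_, _, .seq h h', hq⟩

theorem runs_cond {b : Test} {P R : Program} {s : State} {Q : State → ℕ → Prop} :
    Runs (.cond b P R) s Q ↔ (b.holds s → Runs P s fun s' t => Q s' (b.cost + t)) ∧
      (¬ b.holds s → Runs R s fun s' t => Q s' (b.cost + t)) := by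
  constructor
  · rintro ⟨s', t, h, hq⟩
    cases h with
    | condTrue hb h => exact ⟨fun _ => ⟨_, _, h, hq⟩, fun hn => absurd hb hn⟩
    | condFalse hb h => exact ⟨fun hn => absurd hn hb, fun _ => ⟨_, _, h, hq⟩⟩
  · rintro ⟨h1, h2⟩
    by_cases hb : b.holds s
    · obtain ⟨_, _, h, hq⟩ := h1 hb
      exact ⟨_, _, .condTrue hb h, hq⟩
    · obtain ⟨_, _, h, hq⟩ := h2 hb
      exact ⟨_, _, .condFalse hb h, hq⟩

theorem Runs.loopTrue {b : Test} {P : Program} {s : State} {Q : State → ℕ → Prop} (hb : b.holds s)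
    (h : Runs P s fun s' t => Runs (.loop b P) s' fun s'' t' => Q s'' (b.cost + t + t')) :
    Runs (.loop b P) s Q := by
  obtain ⟨s', t, h, s'', t', h', hq⟩ := h
  exact ⟨_, _, .loopTrue hb h h', hq⟩

theorem Runs.loopFalse {b : Test} {P : Program} {s : State} {Q : State → ℕ → Prop}
    (hb : ¬ b.holds s) (h : Q s b.cost) : Runs (.loop b P) s Q :=
  ⟨_, _, .loopFalse hb, h⟩

/-- The integer arrays which a program writes to. -/
def Program.natWrites : Program → List ℕ
  | .skip => []
  | .setNat k _ _ => [k]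
  | .setReal _ _ _ => []
  | .seq P Q => P.natWrites ++ Q.natWrites
  | .cond _ P Q => P.natWrites ++ Q.natWrites
  | .loop _ P => P.natWrites

/-- The real arrays which a program writes to. -/
def Program.realWrites : Program → List ℕ
  | .skip => []
  | .setNat _ _ _ => []
  | .setReal k _ _ => [k]
  | .seq P Q => P.realWrites ++ Q.realWrites
  | .cond _ P Q => P.realWrites ++ Q.realWrites
  | .loop _ P => P.realWrites

/-- The states `s` and `s'` agree in the arrays which `P` does not write to. -/
structure Frame (P : Program) (s s' : State) : Prop where
  nat : ∀ k, k ∉ P.natWrites → s'.nat k = s.nat k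
  real : ∀ k, k ∉ P.realWrites → s'.real k = s.real k

theorem Frame.refl (P : Program) (s : State) : Frame P s s := ⟨fun _ _ => rfl, fun _ _ => rfl⟩

theorem Frame.trans {P : Program} {s s' s'' : State} (h : Frame P s s') (h' : Frame P s' s'') :
    Frame P s s'' :=
  ⟨fun k hk => (h'.nat k hk).trans (h.nat k hk), fun k hk => (h'.real k hk).trans (h.real k hk)⟩

theorem Frame.of_subset {P R : Program} {s s' : State} (h : Frame P s s')
    (hn : P.natWrites ⊆ R.natWrites) (hr : P.realWrites ⊆ R.realWrites) : Frame R s s' :=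
  ⟨fun k hk => h.nat k fun h => hk (hn h), fun k hk => h.real k fun h => hk (hr h)⟩

/-- The lists of written arrays are syntactic, so preservation of a given array by a concrete
program follows by `decide`. -/
theorem Exec.frame {P : Program} {s s' : State} {t : ℕ} (h : Exec P s s' t) : Frame P s s' := by
  induction h with
  | skip s => exact .refl _ _
  | setNat k i e s =>
    refine ⟨fun k' hk' => ?_, fun _ _ => rfl⟩
    have : k' ≠ k := by simpa [Program.natWrites] using hk'
    funext i'
    simp [State.setNat, this]
  | setReal k i e s =>
    refine ⟨fun _ _ => rfl, fun k' hk' => ?_⟩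
    have : k' ≠ k := by simpa [Program.realWrites] using hk'
    funext i'
    simp [State.setReal, this]
  | seq _ _ ih ih' =>
    exact (ih.of_subset (List.subset_append_left _ _) (List.subset_append_left _ _)).trans
      (ih'.of_subset (List.subset_append_right _ _) (List.subset_append_right _ _))
  | condTrue _ _ ih =>
    exact ih.of_subset (List.subset_append_left _ _) (List.subset_append_left _ _)
  | condFalse _ _ ih =>
    exact ih.of_subset (List.subset_append_right _ _) (List.subset_append_right _ _)
  | loopTrue _ _ _ ih ih' =>
    exact Frame.trans (P := .loop _ _) ⟨ih.nat, ih.real⟩ ih'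
  | loopFalse _ => exact .refl _ _

theorem Runs.frame {P : Program} {s : State} {Q : State → ℕ → Prop} (h : Runs P s Q) :
    Runs P s fun s' t => Q s' t ∧ Frame P s s' := by
  obtain ⟨s', t, h, hq⟩ := h
  exact ⟨s', t, h, hq, h.frame⟩

/-- A loop with `N` rounds of at most `T` steps and the invariant `I`. -/
theorem Runs.loop {b : Test} {P : Program} {s : State} (I : ℕ → State → Prop) (N T : ℕ)
    (h0 : I 0 s)
    (hP : ∀ k < N, ∀ s', Frame P s s' → I k s' →
      b.holds s' ∧ Runs P s' fun s'' t => I (k + 1) s'' ∧ t ≤ T)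
    (hN : ∀ s', Frame P s s' → I N s' → ¬ b.holds s') :
    Runs (.loop b P) s fun s' t => I N s' ∧ t ≤ N * (b.cost + T) + b.cost := by
  -- Induction on the number `d` of rounds still to come.
  have key : ∀ d k s', k + d = N → Frame P s s' → I k s' →
      Runs (.loop b P) s' fun s'' t => I N s'' ∧ t ≤ d * (b.cost + T) + b.cost := by
    intro d
    induction d with
    | zero =>
      intro k s' hk hf hI
      obtain rfl : k = N := hk
      exact .loopFalse (hN s' hf hI) ⟨hI, by simp⟩
    | succ d ih =>
      intro k s' hk hf hI
      obtain ⟨hb, hr⟩ := hP k (by omega) s' hf hI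
      refine .loopTrue hb (hr.frame.mono ?_)
      rintro s'' t ⟨⟨hI', ht⟩, hf'⟩
      refine (ih (k + 1) s'' (by omega) (hf.trans hf') hI').mono ?_
      rintro s₃ t' ⟨hI₃, ht'⟩
      refine ⟨hI₃, ?_⟩
      rw [Nat.succ_mul]
      omega
  exact key N 0 s (by omega) (.refl _ _) h0

/-! ### Evaluation of straight-line code -/

/-- The first entry of the integer array `k`, used as a variable. -/
abbrev NatExp.var (k : ℕ) : NatExp := .get k (.lit 0)

/-- The assignment of a value to the first entry of the integer array `k`. -/
abbrev Program.assign (k : ℕ) (e : NatExp) : Program := .setNat k (.lit 0) e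

theorem State.nat_setNat (s : State) (k i v k' i' : ℕ) :
    (s.setNat k i v).nat k' i' = if k' = k ∧ i' = i then v else s.nat k' i' := rfl

theorem State.real_setNat (s : State) (k i v : ℕ) : (s.setNat k i v).real = s.real := rfl

theorem State.nat_setReal (s : State) (k i : ℕ) (v : ℝ) : (s.setReal k i v).nat = s.nat := rfl

theorem State.real_setReal (s : State) (k i : ℕ) (v : ℝ) (k' i' : ℕ) :
    (s.setReal k i v).real k' i' = if k' = k ∧ i' = i then v else s.real k' i' := rfl

attribute [local simp] runs_skip runs_setNat runs_setReal runs_seq runs_cond NatExp.eval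
  NatExp.cost RealExp.eval RealExp.cost Test.holds Test.cost State.nat_setNat State.real_setNat
  State.nat_setReal State.real_setReal

/-! ### The tables of the program

The program uses the integer arrays
* `2`: the number `4 ^ n`,
* `3`, `6`, `11`, `13`: counters and auxiliary variables,
* `4`, `5`: the tables of the quotients and remainders of division by four,
* `7`, `8`: a record and its digits,
* `9`, `10`: a stack of truth values and its height,
* `12`, `14`: the number of an atom and its digits,
* `15`: the next record,

and the real arrays
* `1`: the probabilities of the expression after the records,
* `2`, `3`: the probability of leaving a record, and the corresponding weighted sum. -/

open NatExp Program in
/-- Computes `4 ^ n`. -/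
def powerProg : Program :=
  .seq (assign 2 (.lit 1)) <| .seq (assign 3 (.lit 0)) <|
  .loop (.natLt (var 3) (var 0)) <|
    .seq (assign 2 (.add (.add (var 2) (var 2)) (.add (var 2) (var 2))))
      (assign 3 (.add (var 3) (.lit 1)))

theorem runs_powerProg {n : ℕ} {s : State} (hn : s.nat 0 0 = n) :
    Runs powerProg s fun s' t => s'.nat 2 0 = 4 ^ n ∧ t ≤ n * 100 + 100 := by
  simp only [powerProg, runs_seq, runs_setNat, NatExp.eval, NatExp.cost]
  refine (Runs.loop (fun k s' => s'.nat 3 0 = k ∧ s'.nat 2 0 = 4 ^ k) n 50 ?_ ?_ ?_).mono ?_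
  · simp
  · rintro k hk s' hf ⟨h3, h2⟩
    have h0 : s'.nat 0 = s.nat 0 := by
      rw [hf.nat 0 (by decide)]
      funext i; simp
    simp [h0, h3, h2, hn, hk]
    ring
  · rintro s' hf ⟨h3, h2⟩
    have h0 : s'.nat 0 = s.nat 0 := by
      rw [hf.nat 0 (by decide)]
      funext i; simp
    simp [h0, h3, hn]
  · rintro s' t ⟨⟨h3, h2⟩, ht⟩
    simp at ht
    exact ⟨h2, by omega⟩

open NatExp Program in
/-- Computes the tables of quotients and remainders. -/
def tableProg : Program :=
  .seq (assign 6 (.lit 0)) <|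
  .loop (.natLt (var 6) (var 2)) <|
    .seq
      (.cond (.natEq (.get 5 (var 6)) (.lit 3))
        (.seq (.setNat 5 (.add (var 6) (.lit 1)) (.lit 0))
          (.setNat 4 (.add (var 6) (.lit 1)) (.add (.get 4 (var 6)) (.lit 1))))
        (.seq (.setNat 5 (.add (var 6) (.lit 1)) (.add (.get 5 (var 6)) (.lit 1)))
          (.setNat 4 (.add (var 6) (.lit 1)) (.get 4 (var 6)))))
      (assign 6 (.add (var 6) (.lit 1)))

/-- The machine cannot divide natural numbers, so quotients and remainders come from counting
upwards. The entries for `0` are correct because the memory is initially zero, and round `k` writes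
the entries for `k + 1`. -/
theorem runs_tableProg {N : ℕ} {s : State} (hN : s.nat 2 0 = N) (h4 : s.nat 4 0 = 0)
    (h5 : s.nat 5 0 = 0) :
    Runs tableProg s fun s' t =>
      (∀ j < N, s'.nat 4 j = j / 4 ∧ s'.nat 5 j = j % 4) ∧ t ≤ N * 100 + 100 := by
  simp only [tableProg, runs_seq, runs_setNat, NatExp.eval, NatExp.cost]
  refine (Runs.loop (fun k s' => s'.nat 6 0 = k ∧
    ∀ j ≤ k, s'.nat 4 j = j / 4 ∧ s'.nat 5 j = j % 4) N 80 ?_ ?_ ?_).mono ?_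
  · simp [h4, h5]
  · rintro k hk s' hf ⟨h6, h⟩
    have h0 : s'.nat 2 = s.nat 2 := by
      rw [hf.nat 2 (by decide)]
      funext i; simp
    simp only [Test.holds, NatExp.eval, h0, hN, h6, hk, true_and]
    have hk' := h k le_rfl
    simp [h6, hk'.1, hk'.2]
    constructor
    · intro h3 j hj
      split_ifs with hjk
      · subst hjk; omega
      · exact h j (by omega)
    · intro h3 j hj
      split_ifs with hjk
      · subst hjk; omega
      · exact h j (by omega)
  · rintro s' hf ⟨h6, -⟩
    have h0 : s'.nat 2 = s.nat 2 := by
      rw [hf.nat 2 (by decide)]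
      funext i; simp
    simp [h0, h6, hN]
  · rintro s' t ⟨⟨h6, h⟩, ht⟩
    simp at ht
    exact ⟨fun j hj => h j hj.le, by omega⟩

/-- The constants and tables available after the initialisation. -/
structure HasTables (n : ℕ) (s : State) : Prop where
  arity : s.nat 0 0 = n
  power : s.nat 2 0 = 4 ^ n
  quot : ∀ j < 4 ^ n, s.nat 4 j = j / 4
  rem : ∀ j < 4 ^ n, s.nat 5 j = j % 4

theorem HasTables.congr {n : ℕ} {s s' : State} (h : HasTables n s) (h0 : s'.nat 0 = s.nat 0)
    (h2 : s'.nat 2 = s.nat 2) (h4 : s'.nat 4 = s.nat 4) (h5 : s'.nat 5 = s.nat 5) :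
    HasTables n s' :=
  ⟨by rw [h0, h.arity], by rw [h2, h.power], by rw [h4]; exact h.quot, by rw [h5]; exact h.rem⟩

open NatExp Program in
/-- Computes the digits of the variable `src` in the array `dst`. -/
def digitsProg (src dst : ℕ) : Program :=
  .seq (assign 13 (var src)) <| .seq (assign 3 (.lit 0)) <|
  .loop (.natLt (var 3) (var 0)) <|
    .seq (.setNat dst (var 3) (.get 5 (var 13))) <|
    .seq (assign 13 (.get 4 (var 13))) (assign 3 (.add (var 3) (.lit 1)))

/-- The excluded values of `dst` are the arrays that the loop reads or uses as variables. -/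
theorem runs_digitsProg {n x src dst : ℕ} {s : State} (hs : HasTables n s)
    (hdst : dst ∉ [0, 3, 4, 5, 13]) (hx : s.nat src 0 = x) (hxn : x < 4 ^ n) :
    Runs (digitsProg src dst) s fun s' t =>
      (∀ i < n, s'.nat dst i = digit x i) ∧ t ≤ n * 100 + 100 := by
  obtain ⟨d0, d3, d4, d5, d13⟩ : dst ≠ 0 ∧ dst ≠ 3 ∧ dst ≠ 4 ∧ dst ≠ 5 ∧ dst ≠ 13 := by
    simpa using hdst
  simp only [digitsProg, runs_seq, runs_setNat, NatExp.eval, NatExp.cost]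
  refine (Runs.loop (fun k s' => s'.nat 3 0 = k ∧ s'.nat 13 0 = x / 4 ^ k ∧
    ∀ i < k, s'.nat dst i = digit x i) n 60 ?_ ?_ ?_).mono ?_
  · simp [hx]
  · rintro k hk s' hf ⟨h3, h13, h⟩
    have h0 : s'.nat 0 = s.nat 0 := by
      rw [hf.nat 0 (by simp [Program.natWrites, d0.symm])]
      funext i; simp
    have h4 : s'.nat 4 = s.nat 4 := by
      rw [hf.nat 4 (by simp [Program.natWrites, d4.symm])]
      funext i; simp
    have h5 : s'.nat 5 = s.nat 5 := by
      rw [hf.nat 5 (by simp [Program.natWrites, d5.symm])]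
      funext i; simp
    have hlt : x / 4 ^ k < 4 ^ n := (Nat.div_le_self _ _).trans_lt hxn
    simp [h0, h3, h13, h4, h5, hs.arity, hk, d3, d3.symm, d4.symm, d13, d13.symm,
      hs.rem _ hlt, hs.quot _ hlt]
    refine ⟨by rw [pow_succ, Nat.div_div_eq_div_mul], fun i hi => ?_⟩
    split_ifs with hik
    · rw [hik, digit]
    · exact h i (by omega)
  · rintro s' hf ⟨h3, -⟩
    have h0 : s'.nat 0 = s.nat 0 := by
      rw [hf.nat 0 (by simp [Program.natWrites, d0.symm])]
      funext i; simp
    simp [h0, h3, hs.arity]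
  · rintro s' t ⟨⟨-, -, h⟩, ht⟩
    simp at ht
    exact ⟨h, by omega⟩

open NatExp Program in
/-- Computes the next record from the digits of the present one and of an atom. -/
def stepProg : Program :=
  .seq (assign 3 (var 0)) <| .seq (assign 15 (.lit 0)) <|
  .loop (.natLt (.lit 0) (var 3)) <|
    .seq (assign 3 (.sub (var 3) (.lit 1))) <|
    .seq (assign 15 (.add (.add (var 15) (var 15)) (.add (var 15) (var 15)))) <|
    .cond (.natLt (.get 8 (var 3)) (.lit 2))
      (.cond (.natLt (.get 14 (var 3)) (.lit 2))
        (assign 15 (.add (var 15) (.get 8 (var 3))))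
        (assign 15 (.add (var 15) (.get 14 (var 3)))))
      (assign 15 (.add (var 15) (.get 8 (var 3))))

theorem runs_stepProg {n x j : ℕ} {s : State} (hn : s.nat 0 0 = n)
    (h8 : ∀ i < n, s.nat 8 i = digit x i) (h14 : ∀ i < n, s.nat 14 i = digit j i) :
    Runs stepProg s fun s' t => s'.nat 15 0 = step n x j ∧ t ≤ n * 100 + 100 := by
  simp only [stepProg, runs_seq, runs_setNat, NatExp.eval, NatExp.cost]
  -- Horner's scheme from the top: after `k` rounds the variable holds the number formed by the `k`
  -- leading digits.
  refine (Runs.loop (fun k s' => s'.nat 3 0 = n - k ∧ s'.nat 15 0 =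
    ofBaseFour k fun i => stepDigit (digit x (i + (n - k))) (digit j (i + (n - k))))
    n 80 ?_ ?_ ?_).mono ?_
  · simp [hn, ofBaseFour]
  · rintro k hk s' hf ⟨h3, h15⟩
    have e8 : s'.nat 8 = s.nat 8 := by
      rw [hf.nat 8 (by decide)]
      funext i; simp
    have e14 : s'.nat 14 = s.nat 14 := by
      rw [hf.nat 14 (by decide)]
      funext i; simp
    have hi : n - k - 1 < n := by omega
    have hrec : ofBaseFour (k + 1)
        (fun i => stepDigit (digit x (i + (n - (k + 1)))) (digit j (i + (n - (k + 1))))) =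
        4 * s'.nat 15 0 + stepDigit (digit x (n - k - 1)) (digit j (n - k - 1)) := by
      rw [ofBaseFour_succ, h15]
      rw [show 0 + (n - (k + 1)) = n - k - 1 by omega]
      congr 2
      exact ofBaseFour_congr fun i _ => by rw [show i + 1 + (n - (k + 1)) = i + (n - k) by omega]
    rw [hrec]
    simp [h3, e8, e14, h8 _ hi, h14 _ hi]
    refine ⟨by omega, fun h => ⟨fun h' => ⟨by omega, ?_⟩, fun h' => ⟨by omega, ?_⟩⟩,
      fun h => ⟨by omega, ?_⟩⟩
    · rw [stepDigit, if_neg (by omega)]; ring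
    · rw [stepDigit, if_pos ⟨by omega, h'⟩]; ring
    · rw [stepDigit, if_neg (by omega)]; ring
  · rintro s' hf ⟨h3, -⟩
    simp [h3]
  · rintro s' t ⟨⟨-, h15⟩, ht⟩
    simp at ht
    refine ⟨?_, by omega⟩
    rw [h15, step]
    exact ofBaseFour_congr fun i _ => by simp

/-! ### Evaluation of the expression for a record -/

/-- The word `L` stands in the array `c` from the position `i` on. -/
def Reads (c : ℕ → ℕ) : ℕ → List ℕ → Prop
  | _, [] => True
  | i, x :: L => c i = x ∧ Reads c (i + 1) L

theorem reads_append {c : ℕ → ℕ} {i : ℕ} {L L' : List ℕ} :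
    Reads c i (L ++ L') ↔ Reads c i L ∧ Reads c (i + L.length) L' := by
  induction L generalizing i with
  | nil => simp [Reads]
  | cons x L ih =>
    simp only [List.cons_append, Reads, ih, List.length_cons, and_assoc]
    rw [show i + 1 + L.length = i + (L.length + 1) by omega]

theorem reads_singleton {c : ℕ → ℕ} {i x : ℕ} : Reads c i [x] ↔ c i = x := by simp [Reads]

theorem reads_getD (L : List ℕ) : Reads (fun i => L.getD i 0) 0 L := by
  -- The prefix `K` already read makes the induction on `L` possible.
  suffices h : ∀ K L : List ℕ, Reads (fun i => (K ++ L).getD i 0) K.length L from h [] L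
  intro K L
  induction L generalizing K with
  | nil => trivial
  | cons x L ih =>
    refine ⟨by simp, ?_⟩
    simpa using ih (K ++ [x])

open NatExp Program in
/-- Processes one letter of the word. -/
def letterProg : Program :=
  .seq
    (.cond (.natEq (.get 1 (var 11)) (.lit 0))
      (.setNat 9 (.sub (var 10) (.lit 1)) (.sub (.lit 1) (.get 9 (.sub (var 10) (.lit 1)))))
      (.cond (.natEq (.get 1 (var 11)) (.lit 1))
        (.seq (assign 10 (.sub (var 10) (.lit 1)))
          (.setNat 9 (.sub (var 10) (.lit 1))
            (.sub (.add (.get 9 (.sub (var 10) (.lit 1))) (.get 9 (var 10))) (.lit 1))))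
        (.cond (.natEq (.get 1 (var 11)) (.lit 2))
          (.seq (assign 10 (.sub (var 10) (.lit 1)))
            (.setNat 9 (.sub (var 10) (.lit 1))
              (.sub (.lit 1) (.sub (.lit 1)
                (.add (.get 9 (.sub (var 10) (.lit 1))) (.get 9 (var 10)))))))
          (.seq (.setNat 9 (var 10) (.sub (.get 8 (.sub (.get 1 (var 11)) (.lit 3))) (.lit 2)))
            (assign 10 (.add (var 10) (.lit 1)))))))
    (assign 11 (.add (var 11) (.lit 1)))

/-- Processes the rest of the word. -/
def wordLoop : Program := .loop (.natLt (.var 11) (.get 0 (.lit 1))) letterProg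

open Classical in
/-- The truth value of an expression for the digits of `x`, as a number. -/
noncomputable def truthValue {n : ℕ} (e : FlatExpr (Fin n)) (x : ℕ) : ℕ :=
  if e.Holds (fun i : Fin n => digit x i = 3) then 1 else 0

/-- The state `s'` arises from `s` by reading the word up to the position `i` and leaving the value
`v` as the top of a stack of height `d + 1`. -/
structure Pushed (d i v : ℕ) (s s' : State) : Prop where
  height : s'.nat 10 0 = d + 1
  position : s'.nat 11 0 = i
  top : s'.nat 9 d = v
  below : ∀ l < d, s'.nat 9 l = s.nat 9 l
  frame : Frame letterProg s s'

theorem Runs.pushed {d i v : ℕ} {s : State}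
    (h : Runs letterProg s fun s' t => s'.nat 10 0 = d + 1 ∧ s'.nat 11 0 = i ∧
      s'.nat 9 d = v ∧ (∀ l < d, s'.nat 9 l = s.nat 9 l) ∧ t ≤ 90) :
    Runs letterProg s fun s' t => Pushed d i v s s' ∧ t ≤ 90 :=
  h.frame.mono fun _ _ ⟨⟨h1, h2, h3, h4, ht⟩, hf⟩ => ⟨⟨h1, h2, h3, h4, hf⟩, ht⟩

theorem runs_letterProg_simple {s : State} {d i a : ℕ} (hd : s.nat 10 0 = d) (hi : s.nat 11 0 = i)
    (hw : s.nat 1 i = a + 3) :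
    Runs letterProg s fun s' t => Pushed d (i + 1) (s.nat 8 a - 2) s s' ∧ t ≤ 90 := by
  refine .pushed ?_
  simp [letterProg, hd, hi, hw]
  intro l hl hne
  omega

theorem runs_letterProg_neg {s : State} {d i : ℕ} (hd : s.nat 10 0 = d + 1) (hi : s.nat 11 0 = i)
    (hw : s.nat 1 i = 0) :
    Runs letterProg s fun s' t => Pushed d (i + 1) (1 - s.nat 9 d) s s' ∧ t ≤ 90 := by
  refine .pushed ?_
  simp [letterProg, hd, hi, hw]
  intro l hl hne
  omega

theorem runs_letterProg_and {s : State} {d i : ℕ} (hd : s.nat 10 0 = d + 2) (hi : s.nat 11 0 = i)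
    (hw : s.nat 1 i = 1) :
    Runs letterProg s fun s' t =>
      Pushed d (i + 1) (s.nat 9 d + s.nat 9 (d + 1) - 1) s s' ∧ t ≤ 90 := by
  refine .pushed ?_
  simp [letterProg, hd, hi, hw]
  intro l hl hne
  omega

theorem runs_letterProg_or {s : State} {d i : ℕ} (hd : s.nat 10 0 = d + 2) (hi : s.nat 11 0 = i)
    (hw : s.nat 1 i = 2) :
    Runs letterProg s fun s' t =>
      Pushed d (i + 1) (1 - (1 - (s.nat 9 d + s.nat 9 (d + 1)))) s s' ∧ t ≤ 90 := by
  refine .pushed ?_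
  simp [letterProg, hd, hi, hw]
  intro l hl hne
  omega

theorem Pushed.trans {d i v d' i' v' : ℕ} {s s' s'' : State} (h : Pushed d i v s s')
    (h' : Pushed d' i' v' s' s'') (hd : d ≤ d') :
    (∀ l < d, s''.nat 9 l = s.nat 9 l) ∧ Frame letterProg s s'' :=
  ⟨fun l hl => (h'.below l (hl.trans_le hd)).trans (h.below l hl), h.frame.trans h'.frame⟩

/-- Truncated subtraction sends the digits `0`, `1`, `2` to `0` and `3` to `1`; undecided counts as
false. -/
theorem truthValue_simple {n : ℕ} (i : Fin n) (x : ℕ) :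
    truthValue (.simple i) x = digit x i - 2 := by
  have := digit_lt x i
  by_cases h : digit x i = 3 <;> simp [truthValue, FlatExpr.Holds, h]
  omega

theorem truthValue_neg {n : ℕ} (e : FlatExpr (Fin n)) (x : ℕ) :
    truthValue e.neg x = 1 - truthValue e x := by
  by_cases h : e.Holds (fun i : Fin n => digit x i = 3) <;> simp [truthValue, FlatExpr.Holds, h]

theorem truthValue_and {n : ℕ} (e f : FlatExpr (Fin n)) (x : ℕ) :
    truthValue (e.and f) x = truthValue e x + truthValue f x - 1 := by
  by_cases h : e.Holds (fun i : Fin n => digit x i = 3) <;>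
    by_cases h' : f.Holds (fun i : Fin n => digit x i = 3) <;>
    simp [truthValue, FlatExpr.Holds, h, h']

theorem truthValue_or {n : ℕ} (e f : FlatExpr (Fin n)) (x : ℕ) :
    truthValue (e.or f) x = 1 - (1 - (truthValue e x + truthValue f x)) := by
  by_cases h : e.Holds (fun i : Fin n => digit x i = 3) <;>
    by_cases h' : f.Holds (fun i : Fin n => digit x i = 3) <;>
    simp [truthValue, FlatExpr.Holds, h, h']

/-- One round of the loop. -/
theorem Runs.wordLoop_of_letterProg {s : State} {R : State → Prop} {T d i v : ℕ}
    (hk : s.nat 11 0 < s.nat 0 1)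
    (h : Runs letterProg s fun s' t => Pushed d i v s s' ∧ t ≤ 90)
    (h' : ∀ s', Pushed d i v s s' → Runs wordLoop s' fun s'' t => R s'' ∧ t ≤ T) :
    Runs wordLoop s fun s' t => R s' ∧ t ≤ T + 100 := by
  refine .loopTrue (by simpa using hk) (h.mono ?_)
  rintro s' t ⟨hp, ht⟩
  refine (h' s' hp).mono ?_
  rintro s'' t' ⟨hR, ht'⟩
  refine ⟨hR, ?_⟩
  simp
  omega

/-- After two subexpressions have been evaluated, a connective replaces their values. -/
theorem Runs.wordLoop_of_connective {s s₁ s₂ : State} {R : State → Prop} {T d i j k u v w : ℕ}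
    (h₁ : Pushed d i u s s₁) (h₂ : Pushed (d + 1) j v s₁ s₂) (hj : j < s.nat 0 1)
    (h : Runs letterProg s₂ fun s' t => Pushed d k w s₂ s' ∧ t ≤ 90)
    (h' : ∀ s', Pushed d k w s s' → Runs wordLoop s' fun s'' t => R s'' ∧ t ≤ T) :
    Runs wordLoop s₂ fun s' t => R s' ∧ t ≤ T + 100 := by
  have hf := h₁.trans h₂ d.le_succ
  refine .wordLoop_of_letterProg (by rwa [h₂.position, hf.2.nat 0 (by decide)]) h fun s' hp => ?_
  exact h' s' ⟨hp.height, hp.position, hp.top, fun l hl => (hp.below l hl).trans (hf.1 l hl),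
    hf.2.trans hp.frame⟩

/-- A subexpression is only a segment of a single loop's run, not a run of its own. The statement is
therefore in continuation style: `h` describes the rest of the loop once the value of `e` has been
pushed, and this permits induction on `e`. -/
theorem runs_wordLoop_of_word {n x : ℕ} (e : FlatExpr (Fin n)) {d i : ℕ} {s : State}
    {R : State → Prop} {T : ℕ} (hd : s.nat 10 0 = d) (hi : s.nat 11 0 = i)
    (hm : i + e.length ≤ s.nat 0 1) (hw : Reads (s.nat 1) i e.word)
    (h8 : ∀ i < n, s.nat 8 i = digit x i)
    (h : ∀ s', Pushed d (i + e.length) (truthValue e x) s s' →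
      Runs wordLoop s' fun s'' t => R s'' ∧ t ≤ T) :
    Runs wordLoop s fun s' t => R s' ∧ t ≤ T + e.length * 100 := by
  induction e generalizing d i s T with
  | simple a =>
    simp only [FlatExpr.word, reads_singleton] at hw
    simp only [FlatExpr.length, one_mul, truthValue_simple, ← h8 a a.2] at hm h ⊢
    exact .wordLoop_of_letterProg (by omega) (runs_letterProg_simple hd hi hw) h
  | neg e ih =>
    simp only [FlatExpr.word, reads_append, reads_singleton, FlatExpr.length_word] at hw
    simp only [FlatExpr.length, truthValue_neg] at hm h ⊢
    rw [show T + (e.length + 1) * 100 = (T + 100) + e.length * 100 by ring]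
    refine ih hd hi (by omega) hw.1 h8 fun s₁ h₁ => ?_
    have hl := runs_letterProg_neg h₁.height h₁.position
      (by rw [h₁.frame.nat 1 (by decide)]; exact hw.2)
    rw [h₁.top] at hl
    refine .wordLoop_of_letterProg ?_ hl fun s' hp => ?_
    · rw [h₁.position, h₁.frame.nat 0 (by decide)]
      omega
    · exact h s' ⟨hp.height, hp.position, hp.top,
        fun l hl => (hp.below l hl).trans (h₁.below l hl), h₁.frame.trans hp.frame⟩
  | and e f ih ih' =>
    simp only [FlatExpr.word, reads_append, reads_singleton, List.length_append,
      FlatExpr.length_word] at hw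
    simp only [FlatExpr.length, truthValue_and] at hm h ⊢
    rw [show T + (e.length + f.length + 1) * 100 = (T + 100 + f.length * 100) + e.length * 100 by
      ring]
    refine ih hd hi (by omega) hw.1.1 h8 fun s₁ h₁ => ?_
    -- The second operand is evaluated one level higher, so the value of the first survives beneath
    -- it.
    refine ih' h₁.height h₁.position ?_ ?_ ?_ fun s₂ h₂ => ?_
    · rw [h₁.frame.nat 0 (by decide)]; omega
    · rw [h₁.frame.nat 1 (by decide)]; exact hw.1.2
    · rw [h₁.frame.nat 8 (by decide)]; exact h8
    have hl := runs_letterProg_and h₂.height h₂.position (by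
      rw [h₂.frame.nat 1 (by decide), h₁.frame.nat 1 (by decide), add_assoc]; exact hw.2)
    rw [h₂.below d d.lt_succ_self, h₁.top, h₂.top] at hl
    refine .wordLoop_of_connective h₁ h₂ (by omega) hl ?_
    simpa only [add_assoc] using h
  | or e f ih ih' =>
    simp only [FlatExpr.word, reads_append, reads_singleton, List.length_append,
      FlatExpr.length_word] at hw
    simp only [FlatExpr.length, truthValue_or] at hm h ⊢
    rw [show T + (e.length + f.length + 1) * 100 = (T + 100 + f.length * 100) + e.length * 100 by
      ring]
    refine ih hd hi (by omega) hw.1.1 h8 fun s₁ h₁ => ?_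
    refine ih' h₁.height h₁.position ?_ ?_ ?_ fun s₂ h₂ => ?_
    · rw [h₁.frame.nat 0 (by decide)]; omega
    · rw [h₁.frame.nat 1 (by decide)]; exact hw.1.2
    · rw [h₁.frame.nat 8 (by decide)]; exact h8
    have hl := runs_letterProg_or h₂.height h₂.position (by
      rw [h₂.frame.nat 1 (by decide), h₁.frame.nat 1 (by decide), add_assoc]; exact hw.2)
    rw [h₂.below d d.lt_succ_self, h₁.top, h₂.top] at hl
    refine .wordLoop_of_connective h₁ h₂ (by omega) hl ?_
    simpa only [add_assoc] using h

/-- Evaluates the expression for the digits of a record. -/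
def evalProg : Program :=
  .seq (.assign 10 (.lit 0)) <| .seq (.assign 11 (.lit 0)) wordLoop

theorem runs_evalProg {n x : ℕ} (e : FlatExpr (Fin n)) {s : State} (hm : s.nat 0 1 = e.length)
    (hw : Reads (s.nat 1) 0 e.word) (h8 : ∀ i < n, s.nat 8 i = digit x i) :
    Runs evalProg s fun s' t => s'.nat 9 0 = truthValue e x ∧ t ≤ e.length * 100 + 100 := by
  simp only [evalProg, runs_seq, runs_setNat, NatExp.eval, NatExp.cost]
  refine (runs_wordLoop_of_word (x := x) e (d := 0) (i := 0) (T := 50)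
    (R := fun s' => s'.nat 9 0 = truthValue e x) ?_ ?_ ?_ ?_ ?_ fun s' h => ?_).mono ?_
  · simp
  · simp
  · simp [hm]
  · exact hw
  · simpa using h8
  -- The position now equals the length of the word; all that remains is the failing test.
  · refine .loopFalse ?_ ⟨h.top, by simp⟩
    simp [h.position, h.frame.nat 0 (by decide), hm]
  · rintro s' t ⟨h, ht⟩
    exact ⟨h, by omega⟩

/-! ### The whole program -/

open NatExp Program in
/-- Processes one atom in the computation of the probability after a record. -/
def atomProg : Program :=
  .seq (digitsProg 12 14) <| .seq stepProg <|
  .seq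
    (.cond (.natEq (var 15) (var 7)) .skip
      (.seq (.setReal 2 (.lit 0) (.add (.get 2 (.lit 0)) (.get 0 (var 12))))
        (.setReal 3 (.lit 0)
          (.add (.get 3 (.lit 0)) (.mul (.get 0 (var 12)) (.get 1 (var 15)))))))
    (assign 12 (.add (var 12) (.lit 1)))

open NatExp Program in
/-- Computes the probability of leaving a record and the corresponding weighted sum. -/
def sumProg : Program :=
  .seq (.setReal 2 (.lit 0) .zero) <| .seq (.setReal 3 (.lit 0) .zero) <|
  .seq (assign 12 (.lit 0)) <| .loop (.natLt (var 12) (var 2)) atomProg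

theorem runs_atomProg {n x j : ℕ} {s : State} {p F : ℕ → ℝ} {u v : ℝ} (hs : HasTables n s)
    (hx : s.nat 7 0 = x) (hxn : x < 4 ^ n) (h8 : ∀ i < n, s.nat 8 i = digit x i)
    (hj : s.nat 12 0 = j) (hjn : j < 4 ^ n) (hp : s.real 0 j = p j)
    (hF : ∀ y, x < y → y < 4 ^ n → s.real 1 y = F y) (hu : s.real 2 0 = u) (hv : s.real 3 0 = v) :
    Runs atomProg s fun s' t => (s'.nat 12 0 = j + 1 ∧
      s'.real 2 0 = u + (if step n x j = x then 0 else p j) ∧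
      s'.real 3 0 = v + (if step n x j = x then 0 else p j * F (step n x j))) ∧
      t ≤ n * 200 + 300 := by
  simp only [atomProg, runs_seq]
  refine (runs_digitsProg hs (by decide) hj hjn).frame.mono ?_
  rintro s₁ t₁ ⟨⟨h14, ht₁⟩, f₁⟩
  have n₁ : ∀ k, k ∉ (digitsProg 12 14).natWrites → s₁.nat k = s.nat k := f₁.nat
  have r₁ : s₁.real = s.real := funext fun k => f₁.real k (by simp [digitsProg, Program.realWrites])
  refine (runs_stepProg (by rw [n₁ 0 (by decide), hs.arity]) (by rwa [n₁ 8 (by decide)])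
    h14).frame.mono ?_
  rintro s₂ t₂ ⟨⟨h15, ht₂⟩, f₂⟩
  have h7 : s₂.nat 7 0 = x := by rw [f₂.nat 7 (by decide), n₁ 7 (by decide), hx]
  have h12 : s₂.nat 12 0 = j := by rw [f₂.nat 12 (by decide), n₁ 12 (by decide), hj]
  have r₂ : s₂.real = s.real :=
    (funext fun k => f₂.real k (by simp [stepProg, Program.realWrites])).trans r₁
  simp [h7, h12, h15, r₂, hu, hv, hp]
  refine ⟨fun _ => by omega, fun h => ?_⟩
  -- A step that changes the record increases it, so the required probability is already in the
  -- table.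
  have hlt := lt_of_le_of_ne (le_step j hxn) (Ne.symm h)
  exact ⟨⟨fun h' => absurd h' h, by rw [if_neg h, hF _ hlt (step_lt n x j)]⟩, by omega⟩

theorem runs_sumProg {n x : ℕ} {s : State} {p F : ℕ → ℝ} (hs : HasTables n s)
    (hx : s.nat 7 0 = x) (hxn : x < 4 ^ n) (h8 : ∀ i < n, s.nat 8 i = digit x i)
    (hp : ∀ j < 4 ^ n, s.real 0 j = p j) (hF : ∀ y, x < y → y < 4 ^ n → s.real 1 y = F y) :
    Runs sumProg s fun s' t => (s'.real 2 0 = leaveProb n p x ∧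
      s'.real 3 0 = ∑ j ∈ Finset.range (4 ^ n),
        if step n x j = x then 0 else p j * F (step n x j)) ∧
      t ≤ 4 ^ n * (n * 200 + 310) + 100 := by
  simp only [sumProg, runs_seq, runs_setNat, runs_setReal, NatExp.eval, NatExp.cost, RealExp.eval,
    RealExp.cost]
  refine (Runs.loop (fun k s' => s'.nat 12 0 = k ∧
    s'.real 2 0 = ∑ j ∈ Finset.range k, (if step n x j = x then 0 else p j) ∧
    s'.real 3 0 = ∑ j ∈ Finset.range k, (if step n x j = x then 0 else p j * F (step n x j)))
    (4 ^ n) (n * 200 + 300) ?_ ?_ ?_).mono ?_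
  · simp
  · rintro k hk s' hf ⟨h12, h2, h3⟩
    have en : ∀ i, i ∉ atomProg.natWrites → i ≠ 12 → s'.nat i = s.nat i := fun i hi hi' => by
      rw [hf.nat i hi]
      funext l; simp [hi']
    have er : ∀ i, i ∉ atomProg.realWrites → i ≠ 2 → i ≠ 3 → s'.real i = s.real i :=
      fun i hi hi' hi'' => by
        rw [hf.real i hi]
        funext l; simp [hi', hi'']
    have hs' : HasTables n s' := hs.congr (en 0 (by decide) (by decide))
      (en 2 (by decide) (by decide)) (en 4 (by decide) (by decide)) (en 5 (by decide) (by decide))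
    refine ⟨by simp [h12, hs'.power, hk], ?_⟩
    simp only [Finset.sum_range_succ]
    refine runs_atomProg hs' ?_ hxn ?_ h12 hk ?_ ?_ h2 h3
    · rw [en 7 (by decide) (by decide), hx]
    · rwa [en 8 (by decide) (by decide)]
    · rw [er 0 (by decide) (by decide) (by decide), hp k hk]
    · rwa [er 1 (by decide) (by decide) (by decide)]
  · rintro s' hf ⟨h12, -⟩
    have : s'.nat 2 = s.nat 2 := by
      rw [hf.nat 2 (by decide)]
      funext l; simp
    simp [h12, this, hs.power]
  · rintro s' t ⟨⟨-, h2, h3⟩, ht⟩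
    simp at ht
    refine ⟨⟨h2, h3⟩, ?_⟩
    have : 4 ^ n * (5 + (n * 200 + 300)) ≤ 4 ^ n * (n * 200 + 310) :=
      Nat.mul_le_mul_left _ (by omega)
    omega

open NatExp Program in
/-- Computes the probability of the expression after the preceding record. -/
def recordProg : Program :=
  .seq (assign 7 (.sub (var 7) (.lit 1))) <| .seq (digitsProg 7 8) <| .seq evalProg <|
  .seq sumProg <|
  .cond (.realEq (.get 2 (.lit 0)) .zero)
    (.cond (.natEq (var 9) (.lit 1)) (.setReal 1 (var 7) .one) (.setReal 1 (var 7) .zero))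
    (.setReal 1 (var 7) (.div (.get 3 (.lit 0)) (.get 2 (.lit 0))))

/-- The word and the probabilities as part of a state. -/
structure HasInput {n : ℕ} (e : FlatExpr (Fin n)) (p : ℕ → ℝ) (s : State) : Prop where
  length : s.nat 0 1 = e.length
  word : Reads (s.nat 1) 0 e.word
  table : ∀ j < 4 ^ n, s.real 0 j = p j

theorem HasInput.congr {n : ℕ} {e : FlatExpr (Fin n)} {p : ℕ → ℝ} {s s' : State}
    (h : HasInput e p s) (h0 : s'.nat 0 = s.nat 0) (h1 : s'.nat 1 = s.nat 1)
    (hr : s'.real 0 = s.real 0) : HasInput e p s' :=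
  ⟨by rw [h0, h.length], by rw [h1]; exact h.word, by rw [hr]; exact h.table⟩

/-- The recursion which determines the probabilities of an expression after the records. -/
def Solves {n : ℕ} (e : FlatExpr (Fin n)) (p F : ℕ → ℝ) : Prop :=
  ∀ x < 4 ^ n, F x = if leaveProb n p x = 0 then (truthValue e x : ℝ) else
    (∑ j ∈ Finset.range (4 ^ n), if step n x j = x then 0 else p j * F (step n x j)) /
      leaveProb n p x

/-- The counter enters one above the record to be treated, so that the last round, started at `1`,
handles record `0`. -/
theorem runs_recordProg {n x : ℕ} {e : FlatExpr (Fin n)} {s : State} {p F : ℕ → ℝ}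
    (hF : Solves e p F) (hs : HasTables n s) (hi : HasInput e p s) (hx : s.nat 7 0 = x + 1)
    (hxn : x < 4 ^ n) (h1 : ∀ y, x < y → y < 4 ^ n → s.real 1 y = F y) :
    Runs recordProg s fun s' t => (s'.nat 7 0 = x ∧ ∀ y, x ≤ y → y < 4 ^ n → s'.real 1 y = F y) ∧
      t ≤ 4 ^ n * (n * 200 + 310) + n * 100 + e.length * 100 + 400 := by
  simp only [recordProg, runs_seq]
  rw [runs_setNat]
  have e₀ : ∀ k, k ≠ 7 → (s.setNat 7 0 x).nat k = s.nat k := fun k hk => by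
    funext l; simp [hk]
  simp only [NatExp.eval, hx, Nat.add_sub_cancel, NatExp.cost]
  have hs₀ : HasTables n (s.setNat 7 0 x) :=
    hs.congr (e₀ 0 (by decide)) (e₀ 2 (by decide)) (e₀ 4 (by decide)) (e₀ 5 (by decide))
  have hi₀ : HasInput e p (s.setNat 7 0 x) := hi.congr (e₀ 0 (by decide)) (e₀ 1 (by decide)) rfl
  have h7₀ : (s.setNat 7 0 x).nat 7 0 = x := by simp
  have h1₀ : (s.setNat 7 0 x).real 1 = s.real 1 := rfl
  generalize s.setNat 7 0 x = s₀ at hs₀ hi₀ h7₀ h1₀ ⊢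
  refine (runs_digitsProg hs₀ (by decide) h7₀ hxn).frame.mono ?_
  rintro s₁ t₁ ⟨⟨h8, ht₁⟩, f₁⟩
  have hs₁ := hs₀.congr (f₁.nat 0 (by decide)) (f₁.nat 2 (by decide)) (f₁.nat 4 (by decide))
    (f₁.nat 5 (by decide))
  have hi₁ := hi₀.congr (f₁.nat 0 (by decide)) (f₁.nat 1 (by decide)) (f₁.real 0 (by decide))
  refine (runs_evalProg e hi₁.length hi₁.word h8).frame.mono ?_
  rintro s₂ t₂ ⟨⟨h9, ht₂⟩, f₂⟩
  have hs₂ := hs₁.congr (f₂.nat 0 (by decide)) (f₂.nat 2 (by decide)) (f₂.nat 4 (by decide))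
    (f₂.nat 5 (by decide))
  have hi₂ := hi₁.congr (f₂.nat 0 (by decide)) (f₂.nat 1 (by decide)) (f₂.real 0 (by decide))
  have h7₂ : s₂.nat 7 0 = x := by rw [f₂.nat 7 (by decide), f₁.nat 7 (by decide), h7₀]
  have h1₂ : s₂.real 1 = s.real 1 := by rw [f₂.real 1 (by decide), f₁.real 1 (by decide), h1₀]
  refine (runs_sumProg (F := F) hs₂ h7₂ hxn (by rwa [f₂.nat 8 (by decide)]) hi₂.table
    (by rwa [h1₂])).frame.mono ?_
  rintro s₃ t₃ ⟨⟨⟨h2, h3⟩, ht₃⟩, f₃⟩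
  have h7 : s₃.nat 7 0 = x := by rw [f₃.nat 7 (by decide), h7₂]
  have h9' : s₃.nat 9 0 = truthValue e x := by rw [f₃.nat 9 (by decide), h9]
  have hr : s₃.real 1 = s.real 1 := by rw [f₃.real 1 (by decide), h1₂]
  have hFx := hF x hxn
  have hupd : ∀ v, v = F x → ∀ y, x ≤ y → y < 4 ^ n → (if y = x then v else s.real 1 y) = F y := by
    rintro v rfl y hy hy'
    split_ifs with h
    · rw [h]
    · exact h1 y (by omega) hy'
  simp [h7, h9', hr, h2, h3]
  refine ⟨fun h => ⟨fun h' => ⟨hupd _ ?_, by omega⟩, fun h' => ⟨hupd _ ?_, by omega⟩⟩,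
    fun h => ⟨hupd _ ?_, by omega⟩⟩
  · rw [hFx, if_pos h, h', Nat.cast_one]
  -- A truth value other than `1` is `0`.
  · have h0 : truthValue e x = 0 := by
      revert h'; unfold truthValue; split_ifs <;> simp
    rw [hFx, if_pos h, h0, Nat.cast_zero]
  · rw [hFx, if_neg h]

open NatExp Program in
/-- Computes the probability of an expression. -/
def psProg : Program :=
  .seq powerProg <| .seq tableProg <| .seq (assign 7 (var 2)) <|
  .loop (.natLt (.lit 0) (var 7)) recordProg

/-- No probability enters here: the program computes any solution of the triangular recursion, for
an arbitrary table `p`. -/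
theorem runs_psProg {n : ℕ} {e : FlatExpr (Fin n)} {p F : ℕ → ℝ} (hF : Solves e p F) :
    Runs psProg (inputState e p) fun s' t => s'.real 1 0 = F 0 ∧
      t ≤ 4 ^ n * (4 ^ n * (n * 200 + 310) + n * 100 + e.length * 100 + 410) +
        4 ^ n * 100 + n * 100 + 400 := by
  simp only [psProg, runs_seq]
  have hi : HasInput e p (inputState e p) :=
    ⟨by simp [inputState, e.length_word], reads_getD e.word, fun j hj => by simp [inputState, hj]⟩
  refine (runs_powerProg (n := n) (by simp [inputState])).frame.mono ?_
  rintro s₁ t₁ ⟨⟨h2, ht₁⟩, f₁⟩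
  refine (runs_tableProg h2 (by rw [f₁.nat 4 (by decide)]; simp [inputState])
    (by rw [f₁.nat 5 (by decide)]; simp [inputState])).frame.mono ?_
  rintro s₂ t₂ ⟨⟨h45, ht₂⟩, f₂⟩
  have hs₂ : HasTables n s₂ := ⟨by
    rw [f₂.nat 0 (by decide), f₁.nat 0 (by decide)]; simp [inputState],
    by rw [f₂.nat 2 (by decide), h2], fun j hj => (h45 j hj).1, fun j hj => (h45 j hj).2⟩
  have hi₂ := (hi.congr (f₁.nat 0 (by decide)) (f₁.nat 1 (by decide)) (f₁.real 0 (by decide))).congr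
    (f₂.nat 0 (by decide)) (f₂.nat 1 (by decide)) (f₂.real 0 (by decide))
  rw [runs_setNat]
  simp only [NatExp.eval, NatExp.cost, hs₂.power]
  have e₃ : ∀ k, k ≠ 7 → (s₂.setNat 7 0 (4 ^ n)).nat k = s₂.nat k := fun k hk => by
    funext l; simp [hk]
  have hs₃ : HasTables n (s₂.setNat 7 0 (4 ^ n)) :=
    hs₂.congr (e₃ 0 (by decide)) (e₃ 2 (by decide)) (e₃ 4 (by decide)) (e₃ 5 (by decide))
  have hi₃ : HasInput e p (s₂.setNat 7 0 (4 ^ n)) :=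
    hi₂.congr (e₃ 0 (by decide)) (e₃ 1 (by decide)) rfl
  have h7₃ : (s₂.setNat 7 0 (4 ^ n)).nat 7 0 = 4 ^ n := by simp
  generalize s₂.setNat 7 0 (4 ^ n) = s₃ at hs₃ hi₃ h7₃ ⊢
  -- After `k` rounds the `k` largest records are done.
  refine (Runs.loop (fun k s' => s'.nat 7 0 = 4 ^ n - k ∧
    ∀ y, 4 ^ n - k ≤ y → y < 4 ^ n → s'.real 1 y = F y) (4 ^ n)
    (4 ^ n * (n * 200 + 310) + n * 100 + e.length * 100 + 400) ?_ ?_ ?_).mono ?_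
  · exact ⟨by simp [h7₃], fun y h h' => absurd h' (by simpa using h)⟩
  · rintro k hk s' hf ⟨h7, h1⟩
    refine ⟨by simp [h7, hk], ?_⟩
    refine runs_recordProg (x := 4 ^ n - (k + 1)) hF
      (hs₃.congr (hf.nat 0 (by decide)) (hf.nat 2 (by decide)) (hf.nat 4 (by decide))
        (hf.nat 5 (by decide)))
      (hi₃.congr (hf.nat 0 (by decide)) (hf.nat 1 (by decide)) (hf.real 0 (by decide)))
      (by rw [h7]; omega) (by omega) fun y h h' => h1 y (by omega) h'
  · rintro s' hf ⟨h7, -⟩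
    simp [h7]
  · rintro s' t ⟨⟨-, h1⟩, ht⟩
    refine ⟨h1 0 (by simp) (by positivity), ?_⟩
    simp at ht
    have : 4 ^ n * (4 + (4 ^ n * (n * 200 + 310) + n * 100 + e.length * 100 + 400)) ≤
        4 ^ n * (4 ^ n * (n * 200 + 310) + n * 100 + e.length * 100 + 410) :=
      Nat.mul_le_mul_left _ (by omega)
    omega

theorem solves_recordProb {Ω : Type*} [MeasurableSpace Ω] {μ : Measure Ω} [IsProbabilityMeasure μ]
    {n : ℕ} {a b : Fin n → Set Ω} (ha : ∀ i, MeasurableSet (a i)) (hb : ∀ i, MeasurableSet (b i))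
    (e : FlatExpr (Fin n)) :
    Solves e (fun j => μ.real (atom a b j)) (recordProb μ a b e) := by
  intro x _
  split_ifs with h
  · rw [recordProb_of_leaveProb_eq_zero e x h, truthValue]
    split_ifs <;> simp
  · rw [← leaveProb_mul_recordProb ha hb, mul_div_cancel_left₀ _ h]

end PSCond

/-- There are one program and one polynomial such that, for all `n`, all `n`-ary conditional
expressions `e`, all probability spaces and all events `a_i`, `b_i`, the program, given `e` and the
probabilities of the atomic Boolean combinations of the `a_i`, `b_i`, halts with the PS probability
of `e((a_0 | b_0), …, (a_(n-1) | b_(n-1)))` in the first cell of the real array `1`, in time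
polynomial in `max (length of e) (2 ^ n)`. -/
theorem mainTheorem7 :
    ∃ (P : Program) (q : Polynomial ℕ),
      ∀ (n : ℕ) (e : FlatExpr (Fin n)) (Ω : Type*) [MeasurableSpace Ω] (μ : Measure Ω)
        [IsProbabilityMeasure μ] (a b : Fin n → Set Ω),
        (∀ i, MeasurableSet (a i)) → (∀ i, MeasurableSet (b i)) →
        ∃ (s : State) (t : ℕ),
          Exec P (inputState e (fun j => μ.real (atom a b j))) s t ∧
          t ≤ q.eval (max e.length (2 ^ n)) ∧
          s.real 1 0 = (e.map (fun i => (a i, b i))).psProb μ := by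
  -- The bound of `runs_psProg` with `4 ^ n` replaced by `X ^ 2`, and both `n` and the length of `e`
  -- by `X`.
  refine ⟨psProg, .X ^ 2 * (.X ^ 2 * (.X * 200 + 310) + .X * 100 + .X * 100 + 410) +
    .X ^ 2 * 100 + .X * 100 + 400, ?_⟩
  intro n e Ω _ μ _ a b ha hb
  obtain ⟨s, t, hE, hF, ht⟩ := runs_psProg (solves_recordProb (μ := μ) ha hb e)
  refine ⟨s, t, hE, ht.trans ?_, hF.trans (recordProb_zero e)⟩
  have hm : e.length ≤ max e.length (2 ^ n) := le_max_left _ _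
  have h2 : 2 ^ n ≤ max e.length (2 ^ n) := le_max_right _ _
  have hn : n ≤ max e.length (2 ^ n) := Nat.lt_two_pow_self.le.trans h2
  have h4 : 4 ^ n ≤ max e.length (2 ^ n) ^ 2 := by
    calc 4 ^ n = (2 ^ n) ^ 2 := by rw [← pow_mul, mul_comm, pow_mul]; norm_num
      _ ≤ _ := Nat.pow_le_pow_left h2 2
  generalize max e.length (2 ^ n) = M at *
  simp only [Polynomial.eval_add, Polynomial.eval_mul, Polynomial.eval_pow, Polynomial.eval_X,
    Polynomial.eval_ofNat]
  gcongr
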